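/- Let $\mathbf K=(K,\le_{\mathbf K})$ be an abstract elementary class (AEC) in a finitary vocabulary $\tau(\mathbf K)$, with arbitrarily large models; no amalgamation is assumed. Let $\mathrm{LS}(\mathbf K)$ be its Löwenheim–Skolem–Tarski number, that is, the least cardinal $\mu\ge|\tau(\mathbf K)|+\aleph_0$ such that for all $M\in K$ and $A\subseteq|M|$ there is $M_0\le_{\mathbf K}M$ with $A\subseteq|M_0|$ and $\|M_0\|\le|A|+\mu$. **Galois types.** For $N\in K$, $A\subseteq|N|$ and a sequence $\bar b$ from $N$, $\mathrm{gtp}(\bar b/A;N)$ is the class of $(\bar b,A,N)$ under the transitive closure of the following relation: $(\bar b_1,A,N_1)$ and $(\bar b_2,A,N_2)$ are related if there are $N'\in K$ and $\mathbf K$-embeddings $f_\ell:N_\ell\to N'$ fixing $A$ pointwise with $f_1(\bar b_1)=f_2(\bar b_2)$. **Order property.** For cardinals $\kappa,\mu,\theta$, a model $N\in K$ has the $(\kappa,\mu)$-order property of length $\theta$ if there are $\langle\bar a_i:i<\theta\rangle$ with $\bar a_i\in{}^{\kappa}|N|$ and $A\subseteq|N|$ with $|A|\le\mu$ such that $\mathrm{gtp}(\bar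 a_{i_0}\bar a_{i_1}/A;N)\ne\mathrm{gtp}(\bar a_{j_1}\bar a_{j_0}/A;N)$ for all $i_0<i_1<\theta$ and $j_0<j_1<\theta$. The class $\mathbf K$ has it if some $N\in K$ has it. **EM blueprints.** Let $\Phi=\{p_n:n<\omega\}$, where each $p_n$ is a complete $n$-variable quantifier-free type in a fixed vocabulary $\tau(\Phi)\supseteq\tau(\mathbf K)$, be proper for linear orders: for every linear order $I$ there is a $\tau(\Phi)$-structure $\mathrm{EM}(I,\Phi)$ (unique up to isomorphism over $I$) that contains $I$, is the closure of $I$ under the functions of $\tau(\Phi)$, and in which every tuple $i_0<\dots<i_{n-1}$ from $I$ has quantifier-free type $p_n$. Write $\mathrm{EM}_{\tau(\mathbf K)}(I,\Phi)$ for its reduct to $\tau(\mathbf K)$. Then $\Phi\in\Upsilon_\mu[\mathbf K]$ means that $|\tau(\Phi)|\le\mu$; that $\mathrm{EM}_{\tau(\mathbf K)}(I,\Phi)\in K$ has cardinality $|I|+|\tau(\Phi)|+\mathrm{LS}(\mathbf K)$ for every linear order $I$; and that $\mathrm{EM}_{\tau(\mathbf K)}(I,\Phi)\le_{\mathbf K}\mathrm{EM}_{\tau(\mathbf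 K)}(J,\Phi)$ for all linear orders $I\subseteq J$, where $\mathrm{EM}(I,\Phi)$ is identified with the closure of $I$ in $\mathrm{EM}(J,\Phi)$. **Theorem.** Let $\mathrm{LS}(\mathbf K)<\lambda$, let $\kappa<\lambda$ be a (possibly finite) cardinal, let $\Phi\in\Upsilon_{\mathrm{LS}(\mathbf K)}[\mathbf K]$, and let $N:=\mathrm{EM}_{\tau(\mathbf K)}(\lambda,\Phi)$. If $\mathrm{LS}(\mathbf K)^{\kappa}<\lambda$ and $N$ has the $(\kappa,\mathrm{LS}(\mathbf K))$-order property of length $\left(\mathrm{LS}(\mathbf K)^{\kappa}\right)^+$, then $\mathbf K$ has the $(\kappa,\mathrm{LS}(\mathbf K))$-order property of length $\theta$ for every cardinal $\theta$. -/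

import Mathlib

open FirstOrder FirstOrder.Language Cardinal

universe u

/-! ### Abstract elementary classes -/

/-- The Löwenheim-Skolem-Tarski property with bound `μ` for a class of `L`-structures given by the
predicate `Mem`, with strong substructure relation `Le`: `μ ≥ |L| + ℵ₀`, and every subset `A` of a
member `M` is contained in a strong substructure of `M` of cardinality at most `|A| + μ`. -/
def LSTProperty {L : FirstOrder.Language.{u, u}} (Mem : ∀ (M : Type u) [L.Structure M], Prop)
    (Le : ∀ {N : Type u} [L.Structure N], L.Substructure N → Prop) (μ : Cardinal.{u}) : Prop :=
  L.card + ℵ₀ ≤ μ ∧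
    ∀ (M : Type u) [L.Structure M], Mem M → ∀ A : Set M,
      ∃ S : L.Substructure M, Le S ∧ A ⊆ (S : Set M) ∧ #S ≤ #A + μ

/-- An abstract elementary class in the (finitary) vocabulary `L`. `Mem M` says that the structure
`M` belongs to the class; `Le S`, for a substructure `S` of `N`, says that `S` is a strong
substructure of `N` (that is, `S ≤ N` in the ordering of the class). -/
structure AEC (L : FirstOrder.Language.{u, u}) where
  /-- membership in the class -/
  Mem : ∀ (M : Type u) [L.Structure M], Prop
  /-- the strong substructure relation -/
  Le : ∀ {N : Type u} [L.Structure N], L.Substructure N → Prop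
  mem_of_le : ∀ {N : Type u} [L.Structure N] {S : L.Substructure N}, Le S → Mem N ∧ Mem S
  /-- closure of the class under isomorphisms -/
  mem_equiv : ∀ {M N : Type u} [L.Structure M] [L.Structure N], (M ≃[L] N) → Mem M → Mem N
  /-- invariance of the ordering under isomorphisms -/
  le_equiv : ∀ {M N : Type u} [L.Structure M] [L.Structure N] (f : M ≃[L] N)
    {S : L.Substructure M}, Le S → Le (S.map f.toHom)
  /-- reflexivity of the ordering -/
  le_refl : ∀ {N : Type u} [L.Structure N], Mem N → Le (⊤ : L.Substructure N)
  /-- transitivity of the ordering -/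
  le_trans : ∀ {N : Type u} [L.Structure N] {S : L.Substructure N} {T : L.Substructure S},
    Le S → Le T → Le (T.map S.subtype.toHom)
  /-- coherence: if `S ⊆ T ⊆ N` and both `S` and `T` are strong in `N`, then `S` is strong
  in `T` -/
  coherence : ∀ {N : Type u} [L.Structure N] {S T : L.Substructure N},
    S ≤ T → Le S → Le T → Le (S.comap T.subtype.toHom)
  /-- the union of a strongly increasing chain (indexed by a limit ordinal) of members is a member,
  and is a strong extension of each member of the chain -/
  chain : ∀ {N : Type u} [L.Structure N] {ι : Type u} [LinearOrder ι] [WellFoundedLT ι]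
    [Nonempty ι] [NoMaxOrder ι] (S : ι → L.Substructure N), Monotone S → (∀ i, Mem (S i)) →
    (∀ i j, i < j → Le ((S i).comap (S j).subtype.toHom)) →
    (⋃ i, (S i : Set N)) = Set.univ → Mem N ∧ ∀ i, Le (S i)
  /-- smoothness: if all the members of such a chain are strong in `N`, then so is the union -/
  smooth : ∀ {N : Type u} [L.Structure N] {ι : Type u} [LinearOrder ι] [WellFoundedLT ι]
    [Nonempty ι] [NoMaxOrder ι] (S : ι → L.Substructure N), Monotone S →
    (∀ i j, i < j → Le ((S i).comap (S j).subtype.toHom)) → (∀ i, Le (S i)) →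
    ∀ T : L.Substructure N, (T : Set N) = ⋃ i, (S i : Set N) → Le T
  /-- the Löwenheim-Skolem-Tarski axiom -/
  exists_lst : ∃ μ : Cardinal.{u}, LSTProperty Mem Le μ

namespace AEC

variable {L : FirstOrder.Language.{u, u}} (K : AEC L)

/-- The Löwenheim-Skolem-Tarski number of the class. -/
noncomputable def LS : Cardinal.{u} :=
  sInf {μ | LSTProperty K.Mem K.Le μ}

/-- The class has arbitrarily large models. -/
def ArbitrarilyLarge : Prop :=
  ∀ μ : Cardinal.{u}, ∃ (M : Type u) (_ : L.Structure M), K.Mem M ∧ μ ≤ #M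

/-- An `L`-embedding between members of the class is a `K`-embedding if its range is a strong
substructure of its codomain. -/
def IsKEmbedding {M N : Type u} [L.Structure M] [L.Structure N] (f : M ↪[L] N) : Prop :=
  K.Mem M ∧ K.Le f.toHom.range

/-! ### Galois types -/

/-- A triple `(b, A, N)` where `N` is in the class, `A` is (identified through the injection `base`
with) a subset of the universe of `N`, and `b` is a sequence from `N` indexed by `β`. -/
structure Triple (A β : Type u) where
  /-- the universe of the model -/
  carrier : Type u
  /-- its structure -/
  [str : L.Structure carrier]
  mem : K.Mem carrier
  /-- the inclusion of the base set -/
  base : A ↪ carrier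
  /-- the sequence -/
  tup : β → carrier

attribute [instance] Triple.str

/-- Atomic equivalence of triples over the same set `A`: the two models can be `K`-embedded over
`A` in a common member of the class so that the two sequences get the same image. -/
def AtomicEquiv {A β : Type u} (s t : K.Triple A β) : Prop :=
  ∃ (N : Type u) (_ : L.Structure N) (f : s.carrier ↪[L] N) (g : t.carrier ↪[L] N),
    K.IsKEmbedding f ∧ K.IsKEmbedding g ∧
      (∀ a, f (s.base a) = g (t.base a)) ∧ ∀ j, f (s.tup j) = g (t.tup j)

/-- Galois types over `A` of sequences indexed by `β`: classes of triples modulo the equivalence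
relation generated by atomic equivalence (atomic equivalence being reflexive and symmetric, this is
its transitive closure). -/
def GaloisType (A β : Type u) : Type (u + 1) :=
  Quot (K.AtomicEquiv (A := A) (β := β))

/-- The Galois type of the sequence `b` over the set `A`, as computed in `N`. -/
def gtp {N : Type u} [L.Structure N] (hN : K.Mem N) {β : Type u} (b : β → N) (A : Set N) :
    K.GaloisType A β :=
  Quot.mk _ { carrier := N, mem := hN, base := Function.Embedding.subtype (· ∈ A), tup := b }

/-! ### The order property -/

/-- `N` is a member of the class with the `(κ, μ)`-order property of length `θ`. The concatenation
of two sequences indexed by `κ` is indexed by the disjoint sum. -/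
def ModelHasOrderProperty (N : Type u) [L.Structure N] (κ μ θ : Cardinal.{u}) : Prop :=
  ∃ (hN : K.Mem N) (a : θ.ord.ToType → κ.ord.ToType → N) (A : Set N), #A ≤ μ ∧
    ∀ i₀ i₁ j₀ j₁ : θ.ord.ToType, i₀ < i₁ → j₀ < j₁ →
      K.gtp hN (Sum.elim (a i₀) (a i₁)) A ≠ K.gtp hN (Sum.elim (a j₁) (a j₀)) A

/-- The class has the `(κ, μ)`-order property of length `θ`. -/
def HasOrderPropertyOfLength (κ μ θ : Cardinal.{u}) : Prop :=
  ∃ (N : Type u) (_ : L.Structure N), K.ModelHasOrderProperty N κ μ θ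

/-- The class has the `(κ, μ)`-order property, that is, of every length. -/
def HasOrderProperty (κ μ : Cardinal.{u}) : Prop :=
  ∀ θ : Cardinal.{u}, K.HasOrderPropertyOfLength κ μ θ

end AEC

/-! ### Ehrenfeucht-Mostowski models -/

/-- `M` is the structure generated by the linear order `I` (embedded in `M` by `e`) according to the
quantifier-free types `p n`: the image of `I` generates `M`, and the complete quantifier-free type
of every strictly increasing `n`-tuple from `I` is `p n`. -/
structure IsGeneratedBy {T : FirstOrder.Language.{u, u}} (p : ∀ n : ℕ, Set (T.Formula (Fin n)))
    (I : Type u) [LinearOrder I] (M : Type u) [T.Structure M] (e : I ↪ M) : Prop where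
  closure_eq : Substructure.closure T (Set.range e) = ⊤
  realize_iff : ∀ (n : ℕ) (i : Fin n ↪o I) (φ : T.Formula (Fin n)), φ.IsQF →
    (φ ∈ p n ↔ φ.Realize (fun k => e (i k)))

/-- `Φ = {p n : n < ω}` proper for linear orders, in a vocabulary `τ(Φ)` containing `L`. -/
structure ProperTemplate (L : FirstOrder.Language.{u, u}) where
  /-- the vocabulary `τ(Φ)` -/
  vocab : FirstOrder.Language.{u, u}
  /-- the inclusion of `L` in `τ(Φ)` -/
  incl : L →ᴸ vocab
  incl_injective : incl.Injective
  /-- the `n`-variable quantifier-free types -/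
  p : ∀ n : ℕ, Set (vocab.Formula (Fin n))
  isQF : ∀ (n : ℕ), ∀ φ ∈ p n, φ.IsQF
  /-- a structure can be generated from every linear order -/
  proper : ∀ (I : Type u) [LinearOrder I], ∃ (M : Type u) (_ : vocab.Structure M) (e : I ↪ M),
    IsGeneratedBy p I M e

namespace ProperTemplate

variable {L : FirstOrder.Language.{u, u}} (Φ : ProperTemplate L) (I : Type u) [LinearOrder I]

/-- The universe of `EM(I, Φ)`, which is unique up to isomorphism over `I`. -/
def EM : Type u := (Φ.proper I).choose

/-- The `τ(Φ)`-structure `EM(I, Φ)`. -/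
noncomputable instance instStructureEM : Φ.vocab.Structure (Φ.EM I) :=
  (Φ.proper I).choose_spec.choose

/-- The inclusion of `I` in `EM(I, Φ)`. -/
noncomputable def skeleton : I ↪ Φ.EM I :=
  (Φ.proper I).choose_spec.choose_spec.choose

theorem isGeneratedBy_EM : IsGeneratedBy Φ.p I (Φ.EM I) (Φ.skeleton I) :=
  (Φ.proper I).choose_spec.choose_spec.choose_spec

/-- The `L`-structure on `EM(I, Φ)`: its reduct to the vocabulary `L`. -/
noncomputable instance instStructureReduct : L.Structure (Φ.EM I) :=
  Φ.incl.reduct (Φ.EM I)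

instance instIsExpansionOn : Φ.incl.IsExpansionOn (Φ.EM I) :=
  ⟨fun _ _ => rfl, fun _ _ => rfl⟩

/-- For `I ⊆ J`, the copy of `EM(I, Φ)` in `EM(J, Φ)`, that is, the closure of `I` under the
functions of `τ(Φ)`, as an `L`-substructure of the reduct of `EM(J, Φ)`. -/
noncomputable def subEM {J : Type u} [LinearOrder J] (I : Set J) : L.Substructure (Φ.EM J) :=
  Φ.incl.substructureReduct (Substructure.closure Φ.vocab (Φ.skeleton J '' I))

end ProperTemplate

/-- The set `Υ_μ[K]` of EM blueprints for `K` with vocabulary of cardinality at most `μ`. -/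
structure AEC.IsBlueprint {L : FirstOrder.Language.{u, u}} (K : AEC L) (μ : Cardinal.{u})
    (Φ : ProperTemplate L) : Prop where
  card_le : Φ.vocab.card ≤ μ
  mem : ∀ (I : Type u) [LinearOrder I], K.Mem (Φ.EM I)
  card_eq : ∀ (I : Type u) [LinearOrder I], #(Φ.EM I) = #I + Φ.vocab.card + K.LS
  strong : ∀ (J : Type u) [LinearOrder J] (I : Set J), K.Le (Φ.subEM I)

/-!
The sequences `a i` and the elements of `A` are values of `τ(Φ)`-terms at tuples from the skeleton
`λ`. The Galois type of a tuple of terms depends only on the order type of the arguments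
(`AEC.IsBlueprint.galoisType_eq`): the arguments generate a copy of one and the same EM model, which
is strong in both ambient models. So it is enough to find long families of tuples of arguments, in
other linear orders, in which pairs have the order type of a pair occurring in `λ`.

Write `χ = LS(K) ^ κ`; it is infinite, because the hypothesis excludes `κ = 0`. Counting terms
shows that `χ⁺` many of the `a i` are given by the same terms, hence by sequences of ordinals `s i`
indexed by a set `D`, finite if `κ` is and of cardinality at most `κ` otherwise, so that `χ ^ |D| ≤
χ`. As `λ` is well-ordered, only few cuts are realized over the at most `LS(K)` arguments needed
for `A` (`exists_cut_code`), so that these cuts, and the order type of each single `s i`, may be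
assumed constant too. Three indices with all pairs alike need not exist for arbitrary colorings of
the pairs from `χ⁺` with `χ` colors, but here the colors are order types of pairs of sequences of
ordinals, and a closure argument does (`StrictlyBounding.exists_homogeneous_triple`). Finally,
three indiscernible sequences can be stretched along any linear order `Θ`
(`OrderIndiscernible.exists_stretch`): the pattern of pairs defines a relation on `Θ × X`, where
`X` consists of `D` and the arguments needed for `A`, and its transitivity only concerns three
indices at a time.
-/

/-! ### Maps between Ehrenfeucht-Mostowski models -/

section Generated

variable {T : FirstOrder.Language.{u, u}}

/-- Every term with variables in a linear order is, uniformly in any large enough finite set `s'` of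
variables, a term in the increasing enumeration of `s'`. This is the form in which the types
`p n` of a template, which speak of increasing tuples only, can be applied to it. -/
theorem exists_relabel_orderEmbOfFin {I : Type u} [LinearOrder I] (t : T.Term I) :
    ∃ s : Finset I, ∀ s' : Finset I, s ⊆ s' →
      ∃ t' : T.Term (Fin s'.card), t'.relabel (s'.orderEmbOfFin rfl) = t := by
  induction t with
  | var x =>
    refine ⟨{x}, fun s' hs => ?_⟩
    have hx : x ∈ Set.range (s'.orderEmbOfFin rfl) := by
      rw [Finset.range_orderEmbOfFin]
      exact hs (by simp)
    obtain ⟨k, hk⟩ := hx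
    exact ⟨Term.var k, by simp [hk]⟩
  | func f ts ih =>
    choose s hs using ih
    refine ⟨Finset.univ.biUnion s, fun s' hs' => ?_⟩
    have h := fun i => hs i s' ((Finset.subset_biUnion_of_mem s (Finset.mem_univ i)).trans hs')
    choose t' ht' using h
    exact ⟨Term.func f t', by simp [ht']⟩

variable {p : ∀ n : ℕ, Set (T.Formula (Fin n))} {I J M N : Type u} [LinearOrder I] [LinearOrder J]
  [T.Structure M] [T.Structure N] {e : I ↪ M} {e' : J ↪ N}

namespace IsGeneratedBy

theorem realize_iff_realize (hM : IsGeneratedBy p I M e) (hN : IsGeneratedBy p J N e')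
    (h : I ↪o J) {n : ℕ} (i : Fin n ↪o I) {φ : T.Formula (Fin n)} (hφ : φ.IsQF) :
    φ.Realize (e ∘ i) ↔ φ.Realize ((e' ∘ h) ∘ i) :=
  (hM.realize_iff n i φ hφ).symm.trans (hN.realize_iff n (i.trans h) φ hφ)

theorem term_realize_eq_iff (hM : IsGeneratedBy p I M e) (hN : IsGeneratedBy p J N e')
    (h : I ↪o J) (t₁ t₂ : T.Term I) :
    t₁.realize e = t₂.realize e ↔ t₁.realize (e' ∘ h) = t₂.realize (e' ∘ h) := by
  obtain ⟨s₁, h₁⟩ := exists_relabel_orderEmbOfFin t₁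
  obtain ⟨s₂, h₂⟩ := exists_relabel_orderEmbOfFin t₂
  obtain ⟨t₁', rfl⟩ := h₁ (s₁ ∪ s₂) Finset.subset_union_left
  obtain ⟨t₂', rfl⟩ := h₂ (s₁ ∪ s₂) Finset.subset_union_right
  have := hM.realize_iff_realize hN h ((s₁ ∪ s₂).orderEmbOfFin rfl)
    (φ := t₁'.equal t₂') (BoundedFormula.IsAtomic.equal _ _).isQF
  simpa only [Formula.realize_equal, Term.realize_relabel] using this

theorem relMap_realize_iff (hM : IsGeneratedBy p I M e) (hN : IsGeneratedBy p J N e')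
    (h : I ↪o J) {n : ℕ} (R : T.Relations n) (ts : Fin n → T.Term I) :
    Structure.RelMap R (fun k => (ts k).realize e) ↔
      Structure.RelMap R (fun k => (ts k).realize (e' ∘ h)) := by
  choose s hs using fun k => exists_relabel_orderEmbOfFin (ts k)
  choose t' ht' using fun k => hs k (Finset.univ.biUnion s)
    (Finset.subset_biUnion_of_mem s (Finset.mem_univ k))
  obtain rfl : (fun k => (t' k).relabel ((Finset.univ.biUnion s).orderEmbOfFin rfl)) = ts :=
    funext ht'
  have := hM.realize_iff_realize hN h ((Finset.univ.biUnion s).orderEmbOfFin rfl)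
    (φ := R.formula t') (BoundedFormula.IsAtomic.rel _ _).isQF
  simpa only [Formula.realize_rel, Term.realize_relabel] using this

theorem exists_term_realize_eq (hM : IsGeneratedBy p I M e) (x : M) :
    ∃ t : T.Term I, t.realize e = x := by
  have hx : x ∈ Substructure.closure T (Set.range e) := hM.closure_eq ▸ Substructure.mem_top x
  obtain ⟨t, rfl⟩ := Substructure.mem_closure_iff_exists_term.1 hx
  refine ⟨t.relabel fun y => y.2.choose, ?_⟩
  rw [Term.realize_relabel]
  congr 1
  funext y
  exact y.2.choose_spec

theorem exists_fin_term_realize_eq (hM : IsGeneratedBy p I M e) (x : M) :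
    ∃ (r : Σ n, T.Term (Fin n)) (v : Fin r.1 → I), r.2.realize (e ∘ v) = x := by
  obtain ⟨t, rfl⟩ := hM.exists_term_realize_eq x
  obtain ⟨s, hs⟩ := exists_relabel_orderEmbOfFin t
  obtain ⟨t', rfl⟩ := hs s subset_rfl
  exact ⟨⟨_, t'⟩, s.orderEmbOfFin rfl, Term.realize_relabel.symm⟩

/-- An order embedding of skeletons induces an embedding of the generated structures, sending the
value of a term to the value of the same term at the image tuple. -/
theorem exists_embedding (hM : IsGeneratedBy p I M e) (hN : IsGeneratedBy p J N e')
    (h : I ↪o J) :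
    ∃ F : M ↪[T] N, (∀ t : T.Term I, F (t.realize e) = t.realize (e' ∘ h)) ∧
      F.toHom.range = Substructure.closure T (e' '' Set.range h) := by
  -- The image of `x` is computed from some term for `x`; the choice of the term does not matter.
  choose τ hτ using hM.exists_term_realize_eq
  have key : ∀ t : T.Term I, (τ (t.realize e)).realize (e' ∘ h) = t.realize (e' ∘ h) := fun t =>
    (hM.term_realize_eq_iff hN h _ _).1 (hτ _)
  refine ⟨⟨⟨fun x => (τ x).realize (e' ∘ h), fun x y hxy => ?_⟩, fun {n} f x => ?_,
    fun {n} R x => ?_⟩, key, ?_⟩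
  · rw [← hτ x, ← hτ y]
    exact (hM.term_realize_eq_iff hN h _ _).2 hxy
  · have := key (Term.func f fun k => τ (x k))
    simp only [Term.realize_func, hτ] at this
    exact this
  · have := hM.relMap_realize_iff hN h R fun k => τ (x k)
    simp only [hτ] at this
    exact this.symm
  · rw [Hom.range_eq_map, ← hM.closure_eq, Substructure.map_closure, ← Set.range_comp,
      ← Set.range_comp]
    congr 2
    funext i
    exact key (Term.var i)

end IsGeneratedBy

end Generated

section KEmbedding

variable {L : FirstOrder.Language.{u, u}} {K : AEC L} {Φ : ProperTemplate L} {μ : Cardinal.{u}}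

theorem AEC.isKEmbedding_refl (K : AEC L) {M : Type u} [L.Structure M] (hM : K.Mem M) :
    K.IsKEmbedding (Embedding.refl L M) := by
  refine ⟨hM, ?_⟩
  have : (Embedding.refl L M).toHom.range = ⊤ := by
    ext x
    simp
  rw [this]
  exact K.le_refl hM

theorem AEC.IsBlueprint.exists_isKEmbedding (hΦ : K.IsBlueprint μ Φ) {I J : Type u}
    [LinearOrder I] [LinearOrder J] (h : I ↪o J) :
    ∃ F : Φ.EM I ↪[L] Φ.EM J, K.IsKEmbedding F ∧
      ∀ t : Φ.vocab.Term I, F (t.realize (Φ.skeleton I)) = t.realize (Φ.skeleton J ∘ h) := by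
  obtain ⟨F, hF, hr⟩ := (Φ.isGeneratedBy_EM I).exists_embedding (Φ.isGeneratedBy_EM J) h
  refine ⟨⟨F.toEmbedding, fun {n} f x => F.map_fun' (Φ.incl.onFunction f) x,
    fun {n} R x => F.map_rel' (Φ.incl.onRelation R) x⟩, ⟨hΦ.mem I, ?_⟩, hF⟩
  convert hΦ.strong J (Set.range h) using 1
  apply SetLike.coe_injective
  exact congrArg (fun S : Φ.vocab.Substructure (Φ.EM J) => (S : Set (Φ.EM J))) hr

/-- Two families of the same order type in the skeletons of two models generate a common strong
submodel, in a way compatible with the evaluation of terms. -/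
theorem AEC.IsBlueprint.exists_common_submodel (hΦ : K.IsBlueprint μ Φ) {I J X : Type u}
    [LinearOrder I] [LinearOrder J] {v : X → I} {w : X → J}
    (hvw : ∀ x y, v x ≤ v y ↔ w x ≤ w y) :
    ∃ (P : Type u) (_ : LinearOrder P) (r : X → P) (F : Φ.EM P ↪[L] Φ.EM I)
      (G : Φ.EM P ↪[L] Φ.EM J), K.IsKEmbedding F ∧ K.IsKEmbedding G ∧
      ∀ t : Φ.vocab.Term X,
        F (t.realize (Φ.skeleton P ∘ r)) = t.realize (Φ.skeleton I ∘ v) ∧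
        G (t.realize (Φ.skeleton P ∘ r)) = t.realize (Φ.skeleton J ∘ w) := by
  let P := Set.range v
  let r : X → P := Set.rangeFactorization v
  let g : P → J := fun y => w y.2.choose
  have hg : ∀ x, g (r x) = w x := fun x => by
    have hc : v (r x).2.choose = v x := (r x).2.choose_spec
    exact le_antisymm ((hvw _ _).1 hc.le) ((hvw _ _).1 hc.ge)
  have hgle : ∀ y z : P, g y ≤ g z ↔ y ≤ z := by
    rintro ⟨_, x, rfl⟩ ⟨_, y, rfl⟩
    exact (hg x ▸ hg y ▸ (hvw x y).symm : g (r x) ≤ g (r y) ↔ v x ≤ v y)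
  obtain ⟨F, hF, hFt⟩ := hΦ.exists_isKEmbedding (OrderEmbedding.subtype fun y => y ∈ P)
  obtain ⟨G, hG, hGt⟩ := hΦ.exists_isKEmbedding (OrderEmbedding.ofMapLEIff g hgle)
  refine ⟨P, inferInstance, r, F, G, hF, hG, fun t => ⟨?_, ?_⟩⟩
  · rw [← Term.realize_relabel, hFt, Term.realize_relabel]
    rfl
  · rw [← Term.realize_relabel, hGt, Term.realize_relabel]
    congr 1
    funext x
    exact congrArg _ (hg x)

theorem AEC.IsBlueprint.term_realize_eq_iff (hΦ : K.IsBlueprint μ Φ) {I J X : Type u}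
    [LinearOrder I] [LinearOrder J] {v : X → I} {w : X → J}
    (hvw : ∀ x y, v x ≤ v y ↔ w x ≤ w y) (t₁ t₂ : Φ.vocab.Term X) :
    t₁.realize (Φ.skeleton I ∘ v) = t₂.realize (Φ.skeleton I ∘ v) ↔
      t₁.realize (Φ.skeleton J ∘ w) = t₂.realize (Φ.skeleton J ∘ w) := by
  obtain ⟨P, _, r, F, G, -, -, h⟩ := hΦ.exists_common_submodel hvw
  rw [← (h t₁).1, ← (h t₂).1, ← (h t₁).2, ← (h t₂).2, F.injective.eq_iff, G.injective.eq_iff]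

/-- The Galois type of a sequence of terms, over a set of elements given by terms, depends only on
the order type of the arguments of these terms. -/
theorem AEC.IsBlueprint.galoisType_eq (hΦ : K.IsBlueprint μ Φ) {I J X A β : Type u}
    [LinearOrder I] [LinearOrder J] {v : X → I} {w : X → J}
    (hvw : ∀ x y, v x ≤ v y ↔ w x ≤ w y) (tA : A → Φ.vocab.Term X) (tb : β → Φ.vocab.Term X)
    (b₁ : A ↪ Φ.EM I) (b₂ : A ↪ Φ.EM J)
    (hb₁ : ∀ a, b₁ a = (tA a).realize (Φ.skeleton I ∘ v))
    (hb₂ : ∀ a, b₂ a = (tA a).realize (Φ.skeleton J ∘ w)) :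
    (Quot.mk _ ⟨Φ.EM I, hΦ.mem I, b₁, fun j => (tb j).realize (Φ.skeleton I ∘ v)⟩ :
        K.GaloisType A β) =
      Quot.mk _ ⟨Φ.EM J, hΦ.mem J, b₂, fun j => (tb j).realize (Φ.skeleton J ∘ w)⟩ := by
  obtain ⟨P, _, r, F, G, hF, hG, h⟩ := hΦ.exists_common_submodel hvw
  let b : A ↪ Φ.EM P := ⟨fun a => (tA a).realize (Φ.skeleton P ∘ r), fun a a' haa' =>
    b₁.injective <| by
      rw [hb₁, hb₁, ← (h _).1, ← (h _).1]
      exact congrArg F haa'⟩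
  refine Eq.trans (b := Quot.mk _ ⟨Φ.EM P, hΦ.mem P, b,
    fun j => (tb j).realize (Φ.skeleton P ∘ r)⟩) (Eq.symm (Quot.sound ?_)) (Quot.sound ?_)
  · exact ⟨Φ.EM I, inferInstance, F, Embedding.refl L _, hF, K.isKEmbedding_refl (hΦ.mem I),
      fun a => (h _).1.trans (hb₁ a).symm, fun j => (h _).1⟩
  · exact ⟨Φ.EM J, inferInstance, G, Embedding.refl L _, hG, K.isKEmbedding_refl (hΦ.mem J),
      fun a => (h _).2.trans (hb₂ a).symm, fun j => (h _).2⟩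

/-- Restriction of Galois types to a smaller base set. -/
def AEC.GaloisType.restrict {A B β : Type u} (e : A ↪ B) : K.GaloisType B β → K.GaloisType A β :=
  Quot.map (fun t => ⟨t.carrier, t.mem, e.trans t.base, t.tup⟩) fun _ _ ⟨N, i, f, g, hf, hg, h, h'⟩ =>
    ⟨N, i, f, g, hf, hg, fun a => h (e a), h'⟩

end KEmbedding

/-! ### Long families of sequences in a well-order -/

/-- Every subset of `S` of cardinality at most `χ` has a strict upper bound in `S`. -/
def StrictlyBounding (S : Type u) [LinearOrder S] (χ : Cardinal.{u}) : Prop :=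
  ∀ U : Set S, #U ≤ χ → ∃ i, ∀ j ∈ U, j < i

theorem strictlyBounding_succ {χ : Cardinal.{u}} (hχ : ℵ₀ ≤ χ) :
    StrictlyBounding (Order.succ χ).ord.ToType χ := by
  intro U hU
  by_contra! hcon
  have h1 : Order.cof (Order.succ χ).ord.ToType ≤ #U :=
    Order.cof_le fun i => hcon i
  rw [Ordinal.cof_toType, (isRegular_succ hχ).cof_ord] at h1
  exact absurd (h1.trans hU) (not_le.2 (Order.lt_succ χ))

/-- Pigeonhole principle for linear orders that satisfy `StrictlyBounding`: some fibre of a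
coloring with few colors satisfies it too. -/
theorem StrictlyBounding.exists_fiber {S Γ : Type u} [LinearOrder S] {χ : Cardinal.{u}}
    (hχ : ℵ₀ ≤ χ) (hS : StrictlyBounding S χ) (c : S → Γ) (hΓ : #Γ ≤ χ) :
    ∃ γ, StrictlyBounding {i // c i = γ} χ := by
  by_contra! hcon
  simp only [StrictlyBounding] at hcon
  push Not at hcon
  choose U hU hcof using hcon
  obtain ⟨i, hi⟩ := hS (⋃ γ, Subtype.val '' U γ) <| by
    refine (mk_iUnion_le_sum_mk).trans ((sum_le_sum _ (fun _ => χ) fun γ =>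
      mk_image_le.trans (hU γ)).trans ?_)
    rw [sum_const']
    exact mul_le_of_le hχ hΓ le_rfl
  obtain ⟨j, hj, hij⟩ := hcof (c i) ⟨i, rfl⟩
  exact absurd (hi j (Set.mem_iUnion.2 ⟨_, j, hj, rfl⟩)) (not_lt.2 hij)

/-- A small subset of a long order that, for each assignment `T` of few types over `E`-tuples of
parameters, realizes every type over its own `E`-tuples that is realized above them. It is the
closure of a point under choice of realizations; this closure is small because it is an image of a
type of well-founded trees. -/
theorem exists_small_closed {S E Ξ : Type u} [LinearOrder S] [Nonempty S] {χ : Cardinal.{u}}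
    (hχ : ℵ₀ ≤ χ) (hE : χ ^ #E ≤ χ) (hΞ : #Ξ ≤ χ) (T : S → (E → S) → Ξ) :
    ∃ U : Set S, U.Nonempty ∧ #U ≤ χ ∧ ∀ c : E → S, (∀ e, c e ∈ U) → ∀ i, (∀ e, c e < i) →
      ∃ i' ∈ U, (∀ e, c e < i') ∧ T i' c = T i c := by
  classical
  let ar : Option Ξ → Type u := fun o => o.elim PEmpty fun _ => E
  let step : (Σ o, ar o → S) → S := fun x => match x with
    | ⟨none, _⟩ => Classical.arbitrary S
    | ⟨some τ, c⟩ => if h : ∃ i, (∀ e : E, c e < i) ∧ T i c = τ then h.choose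
        else Classical.arbitrary S
  let ev : WType ar → S := WType.elim S step
  refine ⟨Set.range ev, ⟨_, ⟨none, PEmpty.elim⟩, rfl⟩, ?_, ?_⟩
  · refine mk_range_le.trans (WType.cardinalMk_le_of_le' ?_)
    refine (sum_le_sum _ (fun _ => χ) fun o => ?_).trans ?_
    · cases o with
      | none => simpa [ar] using one_le_aleph0.trans hχ
      | some τ => simpa [ar] using hE
    · rw [sum_const', mk_option]
      exact mul_le_of_le hχ (add_le_of_le hχ hΞ (one_le_aleph0.trans hχ)) le_rfl
  · intro c hc i hi
    choose w hw using hc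
    obtain rfl : (fun e => ev (w e)) = c := funext hw
    have hex : ∃ j, (∀ e : E, ev (w e) < j) ∧ T j (fun e => ev (w e)) = T i fun e => ev (w e) :=
      ⟨i, hi, rfl⟩
    have hval : ev (WType.mk (some (T i fun e => ev (w e))) w) = hex.choose := dif_pos hex
    exact ⟨_, ⟨_, rfl⟩, fun e => hval ▸ hex.choose_spec.1 e, hval ▸ hex.choose_spec.2⟩

/-- In a family of `χ⁺` sequences of ordinals, indexed by `D` with `χ ^ |D| = χ`, there are three
whose pairs all realize the same order type. Let the last one be above a small closed set `U` of
indices, and let `b k` be the least ordinal, among those occurring in `U`, above its `k`-th entry.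
The other two are found in `U` so as to realize its order type over `b`, and, for the middle one,
also over the first. The comparison of an ordinal occurring in `U` with the `k`-th entry of the
last sequence is determined by its comparison with `b k`. -/
theorem StrictlyBounding.exists_homogeneous_triple {S D Λ : Type u} [LinearOrder S]
    [LinearOrder Λ] [WellFoundedLT Λ] {χ : Cardinal.{u}} (hχ : ℵ₀ ≤ χ) (hD : χ ^ #D ≤ χ)
    (hS : StrictlyBounding S χ) (s : S → D → Λ) :
    ∃ i₀ i₁ i₂ : S, i₀ < i₁ ∧ i₁ < i₂ ∧ ∀ d d',
      cmp (s i₀ d) (s i₂ d') = cmp (s i₀ d) (s i₁ d') ∧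
      cmp (s i₁ d) (s i₂ d') = cmp (s i₀ d) (s i₁ d') := by
  classical
  obtain ⟨i', -⟩ := hS ∅ (by simp)
  have : Nonempty S := ⟨i'⟩
  have hE : χ ^ #(Option D) ≤ χ := by
    rw [mk_option, power_add, power_one]
    exact mul_le_of_le hχ hD le_rfl
  have hDχ : #D ≤ χ := by
    refine (cantor' #D ?_).le.trans hD
    exact (one_lt_aleph0).trans_le hχ
  have hle : ∀ {κ₁ : Cardinal.{u}}, κ₁ ≤ χ → κ₁ ^ #D ≤ χ := fun h =>
    (power_le_power_right h).trans hD
  have hΞ : #(Option D → D → D → ULift.{u} Ordering) ≤ χ := by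
    have h3 : #(ULift.{u} Ordering) ≤ χ := (mk_le_aleph0).trans hχ
    simp only [mk_pi, prod_const']
    exact (power_le_power_right (hle (hle h3))).trans hE
  obtain ⟨U, ⟨u₀, hu₀⟩, hUχ, hU⟩ := exists_small_closed (S := S) hχ hE hΞ
    (fun i c e k k' => ULift.up (cmp (s i k) (s (c e) k')))
  obtain ⟨i₂, hi₂⟩ := hS U hUχ
  -- `b k` is the pair of an index in `U` and a coordinate at which the least upper value occurs,
  -- if there is any; otherwise its first component is an arbitrary element of `U`.
  have hb : ∀ k, ∃ b : S × D, b.1 ∈ U ∧ ∀ u ∈ U, ∀ d,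
      (s i₂ k ≤ s u d → s i₂ k ≤ s b.1 b.2 ∧ s b.1 b.2 ≤ s u d) := by
    intro k
    by_cases hne : {x | s i₂ k ≤ x ∧ ∃ u ∈ U, ∃ d, s u d = x}.Nonempty
    · obtain ⟨_, ⟨h1, u, hu, d, rfl⟩, hmin⟩ := wellFounded_lt.has_min _ hne
      exact ⟨⟨u, d⟩, hu, fun u' hu' d' h => ⟨h1, not_lt.1 (hmin _ ⟨h, u', hu', d', rfl⟩)⟩⟩
    · exact ⟨⟨u₀, k⟩, hu₀, fun u hu d h => absurd ⟨_, h, u, hu, d, rfl⟩ hne⟩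
  choose b hbU hbmin using hb
  have hcU : ∀ u ∈ U, ∀ e : Option D, (e.elim u fun k => (b k).1) ∈ U := fun u hu e => by
    cases e with
    | none => exact hu
    | some k => exact hbU k
  have realize : ∀ u ∈ U, ∃ i ∈ U, u < i ∧
      (∀ d d', cmp (s i d) (s u d') = cmp (s i₂ d) (s u d')) ∧
      ∀ k d d', cmp (s i d) (s (b k).1 d') = cmp (s i₂ d) (s (b k).1 d') := by
    intro u hu
    obtain ⟨i, hi, hlt, hT⟩ := hU (fun e => e.elim u fun k => (b k).1) (hcU u hu) i₂
      fun e => hi₂ _ (hcU u hu e)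
    refine ⟨i, hi, hlt none, fun d d' => ?_, fun k d d' => ?_⟩
    · exact congrArg ULift.down (congrFun (congrFun (congrFun hT none) d) d')
    · exact congrArg ULift.down (congrFun (congrFun (congrFun hT (some k)) d) d')
  obtain ⟨i₀, hi₀, -, -, h0b⟩ := realize u₀ hu₀
  obtain ⟨i₁, hi₁, h01, h10, h1b⟩ := realize i₀ hi₀
  have det : ∀ u ∈ U, ∀ v ∈ U, ∀ d k, cmp (s u d) (s (b k).1 (b k).2) =
      cmp (s v d) (s (b k).1 (b k).2) → cmp (s u d) (s i₂ k) = cmp (s v d) (s i₂ k) := by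
    intro u hu v hv d k h
    have hu' := hbmin k u hu d
    have hv' := hbmin k v hv d
    have hlt := cmp_eq_lt_iff (s u d) (s (b k).1 (b k).2)
    have hgt := cmp_eq_gt_iff (s u d) (s (b k).1 (b k).2)
    rw [h, cmp_eq_lt_iff] at hlt
    rw [h, cmp_eq_gt_iff] at hgt
    rcases lt_trichotomy (s u d) (s i₂ k) with h1 | h1 | h1 <;>
      rcases lt_trichotomy (s v d) (s i₂ k) with h2 | h2 | h2 <;>
      first
      | rw [(cmp_compares _ _).eq_lt.2 h1, (cmp_compares _ _).eq_lt.2 h2]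
      | rw [(cmp_compares _ _).eq_eq.2 h1, (cmp_compares _ _).eq_eq.2 h2]
      | rw [(cmp_compares _ _).eq_gt.2 h1, (cmp_compares _ _).eq_gt.2 h2]
      | grind
  have key : ∀ d d', cmp (s i₀ d) (s i₂ d') = cmp (s i₀ d) (s i₁ d') := fun d d' => by
    rw [← cmp_swap (s i₁ d'), h10, cmp_swap]
  refine ⟨i₀, i₁, i₂, h01, hi₂ i₁ hi₁, fun d d' => ⟨key d d', ?_⟩⟩
  rw [← key]
  exact det i₁ hi₁ i₀ hi₀ d d' ((h1b d' d _).trans (h0b d' d _).symm)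

/-- In a well-order there are few cuts over a family `x`: the cut of `a` is coded by the position
of the least member of the family that is at least `a`, and by whether this member is `a`. -/
theorem exists_cut_code {E Λ : Type u} [LinearOrder Λ] [WellFoundedLT Λ] (x : E → Λ) :
    ∃ cut : Λ → Option (E × ULift.{u} Bool), ∀ a b, cut a = cut b →
      ∀ e, cmp (x e) a = cmp (x e) b := by
  classical
  have hleast : ∀ a, (∃ e, a ≤ x e) → ∃ e, a ≤ x e ∧ ∀ e', a ≤ x e' → x e ≤ x e' := by
    rintro a ⟨e, he⟩
    obtain ⟨_, ⟨h1, e', rfl⟩, hmin⟩ := (wellFounded_lt (α := Λ)).has_min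
      {y | a ≤ y ∧ ∃ e, x e = y} ⟨_, he, e, rfl⟩
    exact ⟨e', h1, fun e'' h => not_lt.1 (hmin _ ⟨h, e'', rfl⟩)⟩
  refine ⟨fun a => if h : ∃ e, a ≤ x e then
    some ((hleast a h).choose, ULift.up (decide (x (hleast a h).choose = a))) else none,
    fun a b hab e => ?_⟩
  have hlt : ∀ c, (¬ ∃ e, c ≤ x e) → cmp (x e) c = Ordering.lt := fun c hc =>
    (cmp_eq_lt_iff _ _).2 (not_le.1 fun h => hc ⟨e, h⟩)
  by_cases ha : ∃ e, a ≤ x e <;> by_cases hb : ∃ e, b ≤ x e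
  · simp only [dif_pos ha, dif_pos hb, Option.some.injEq, Prod.mk.injEq, ULift.up.injEq,
      decide_eq_decide] at hab
    obtain ⟨ha1, ha2⟩ := (hleast a ha).choose_spec
    obtain ⟨hb1, hb2⟩ := (hleast b hb).choose_spec
    rw [← hab.1] at hb1 hb2 hab
    have ha3 := ha2 e
    have hb3 := hb2 e
    have hab2 := hab.2
    generalize x (hleast a ha).choose = z at *
    rcases lt_trichotomy (x e) a with h1 | h1 | h1 <;>
      rcases lt_trichotomy (x e) b with h2 | h2 | h2 <;>
      first
      | rw [(cmp_compares _ _).eq_lt.2 h1, (cmp_compares _ _).eq_lt.2 h2]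
      | rw [(cmp_compares _ _).eq_eq.2 h1, (cmp_compares _ _).eq_eq.2 h2]
      | rw [(cmp_compares _ _).eq_gt.2 h1, (cmp_compares _ _).eq_gt.2 h2]
      | grind
  · simp [dif_pos ha, dif_neg hb] at hab
  · simp [dif_pos hb, dif_neg ha] at hab
  · rw [hlt a ha, hlt b hb]

/-- A family of sequences, indexed by a linear order, in which the order type of a pair of
sequences depends only on the order of their indices. -/
def OrderIndiscernible {S X Λ : Type*} [LinearOrder S] [LinearOrder Λ] (s : S → X → Λ) : Prop :=
  ∀ p q p' q', cmp p q = cmp p' q' → ∀ x y, cmp (s p x) (s q y) = cmp (s p' x) (s q' y)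

/-- Among `χ⁺` sequences of ordinals there are three that are indiscernible over a small
family `x` of parameters. -/
theorem StrictlyBounding.exists_orderIndiscernible {S D E Λ : Type u} [LinearOrder S]
    [LinearOrder Λ] [WellFoundedLT Λ] {χ : Cardinal.{u}} (hχ : ℵ₀ ≤ χ) (hD : χ ^ #D ≤ χ)
    (hE : #E ≤ χ) (hS : StrictlyBounding S χ) (s : S → D → Λ) (x : E → Λ) :
    ∃ f : Fin 3 → S, f 0 < f 1 ∧ OrderIndiscernible fun p => Sum.elim x (s (f p)) := by
  obtain ⟨cut, hcut⟩ := exists_cut_code x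
  have hle : ∀ {κ₁ : Cardinal.{u}}, κ₁ ≤ χ → κ₁ ^ #D ≤ χ := fun h =>
    (power_le_power_right h).trans hD
  obtain ⟨γ, hγ⟩ := hS.exists_fiber hχ
    (Γ := (D → Option (E × ULift.{u} Bool)) × (D → D → ULift.{u} Ordering))
    (fun i => (fun d => cut (s i d), fun d d' => ULift.up (cmp (s i d) (s i d')))) <| by
      have h2 : #(ULift.{u} Bool) ≤ χ := mk_le_aleph0.trans hχ
      have h3 : #(ULift.{u} Ordering) ≤ χ := mk_le_aleph0.trans hχ
      rw [mk_prod, lift_id, lift_id]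
      simp only [mk_pi, prod_const', mk_option, mk_prod, lift_id]
      exact mul_le_of_le hχ
        (hle (add_le_of_le hχ (mul_le_of_le hχ hE h2) (one_le_aleph0.trans hχ))) (hle (hle h3))
  obtain ⟨i₀, i₁, i₂, h01, h12, hhom⟩ :=
    hγ.exists_homogeneous_triple hχ hD fun i => s i.1
  let f : Fin 3 → S := ![i₀.1, i₁.1, i₂.1]
  have hf : ∀ p, (fun d => cut (s (f p) d), fun d d' => ULift.up (cmp (s (f p) d) (s (f p) d'))) =
      γ := by
    intro p
    fin_cases p
    exacts [i₀.2, i₁.2, i₂.2]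
  have hx : ∀ p p' e d, cmp (x e) (s (f p) d) = cmp (x e) (s (f p') d) := fun p p' e d =>
    hcut _ _ (congrFun (congrArg Prod.fst ((hf p).trans (hf p').symm)) d) e
  have hint : ∀ p p' d d', cmp (s (f p) d) (s (f p) d') = cmp (s (f p') d) (s (f p') d') :=
    fun p p' d d' => congrArg ULift.down
      (congrFun (congrFun (congrArg Prod.snd ((hf p).trans (hf p').symm)) d) d')
  have hlt : ∀ p q : Fin 3, p < q → ∀ d d',
      cmp (s (f p) d) (s (f q) d') = cmp (s (f 0) d) (s (f 1) d') := by
    intro p q hpq d d'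
    obtain ⟨h02, h12'⟩ := hhom d d'
    fin_cases p <;> fin_cases q <;> first | exact absurd hpq (by decide) | rfl | assumption
  refine ⟨f, h01, fun p q p' q' h => ?_⟩
  rintro (e | d) (e' | d')
  · rfl
  · exact hx _ _ _ _
  · exact cmp_eq_cmp_symm.1 (hx _ _ _ _)
  · change cmp (s (f p) d) (s (f q) d') = cmp (s (f p') d) (s (f q') d')
    rcases lt_trichotomy p q with hpq | rfl | hpq
    · rw [hlt p q hpq, hlt p' q' ((cmp_eq_lt_iff _ _).1 (h ▸ (cmp_eq_lt_iff _ _).2 hpq))]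
    · rw [cmp_self_eq_eq] at h
      obtain rfl := (cmp_eq_eq_iff _ _).1 h.symm
      exact hint _ _ _ _
    · rw [cmp_eq_cmp_symm, hlt q p hpq,
        hlt q' p' ((cmp_eq_gt_iff _ _).1 (h ▸ (cmp_eq_gt_iff _ _).2 hpq))]

/-! ### Stretching three indiscernible sequences -/

theorem exists_fin_three_cmp {Θ : Type*} [LinearOrder Θ] (α β γ : Θ) :
    ∃ p q r : Fin 3, cmp p q = cmp α β ∧ cmp q r = cmp β γ ∧ cmp p r = cmp α γ := by
  have hlt : ∀ {a b : Θ}, a < b → cmp a b = Ordering.lt := (cmp_eq_lt_iff _ _).2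
  have heq : ∀ {a b : Θ}, a = b → cmp a b = Ordering.eq := (cmp_eq_eq_iff _ _).2
  have hgt : ∀ {a b : Θ}, b < a → cmp a b = Ordering.gt := (cmp_eq_gt_iff _ _).2
  rcases lt_trichotomy α β with h1 | h1 | h1 <;> rcases lt_trichotomy β γ with h2 | h2 | h2 <;>
    rcases lt_trichotomy α γ with h3 | h3 | h3 <;>
    first
    | (exfalso; order)
    | (simp only [hlt, heq, hgt, h1, h2, h3]; decide)

/-- Three indiscernible sequences stretch to an indiscernible family indexed by any linear order.
Three sequences suffice because transitivity of the order to be defined involves at most three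
indices. -/
theorem OrderIndiscernible.exists_stretch {X Λ Θ : Type u} [LinearOrder Λ] [LinearOrder Θ]
    {s : Fin 3 → X → Λ} (hs : OrderIndiscernible s) :
    ∃ (J : Type u) (_ : LinearOrder J) (t : Θ → X → J), ∀ α β p q, cmp α β = cmp p q →
      ∀ x y, t α x ≤ t β y ↔ s p x ≤ s q y := by
  classical
  have hle : ∀ p q p' q', cmp p q = cmp p' q' → ∀ x y, s p x ≤ s q y ↔ s p' x ≤ s q' y :=
    fun _ _ _ _ h x y => by
      rw [← not_lt, ← not_lt, ← cmp_eq_gt_iff, ← cmp_eq_gt_iff, hs _ _ _ _ h]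
  let le : Θ × X → Θ × X → Prop := fun a b =>
    ∃ p q, cmp a.1 b.1 = cmp p q ∧ s p a.2 ≤ s q b.2
  have le_iff : ∀ a b p q, cmp a.1 b.1 = cmp p q → (le a b ↔ s p a.2 ≤ s q b.2) :=
    fun a b p q h => ⟨fun ⟨p', q', h', hl⟩ => (hle _ _ _ _ (h'.symm.trans h) _ _).1 hl,
      fun hl => ⟨p, q, h, hl⟩⟩
  let _ : Preorder (Θ × X) :=
    { le := le
      le_refl := fun a => ⟨0, 0, by simp, le_rfl⟩
      le_trans := fun a b c hab hbc => by
        obtain ⟨p, q, r, h1, h2, h3⟩ := exists_fin_three_cmp a.1 b.1 c.1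
        exact ⟨p, r, h3.symm,
          ((le_iff a b p q h1.symm).1 hab).trans ((le_iff b c q r h2.symm).1 hbc)⟩ }
  have total : ∀ a b : Θ × X, a ≤ b ∨ b ≤ a := fun a b => by
    obtain ⟨p, q, -, h, -⟩ := exists_fin_three_cmp a.1 b.1 b.1
    refine (le_total (s p a.2) (s q b.2)).imp (fun h' => ⟨p, q, h.symm, h'⟩)
      fun h' => ⟨q, p, cmp_eq_cmp_symm.1 h.symm, h'⟩
  have : Std.Total (α := Θ × X) (· ≤ ·) := ⟨total⟩
  refine ⟨Antisymmetrization (Θ × X) (· ≤ ·), inferInstance,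
    fun α x => toAntisymmetrization (· ≤ ·) (α, x), fun α β p q h x y => ?_⟩
  rw [toAntisymmetrization_le_toAntisymmetrization_iff]
  exact le_iff _ _ p q h

/-! ### Cardinal arithmetic -/

theorem mk_sigma_fin_le {χ : Cardinal.{u}} (hχ : ℵ₀ ≤ χ) {B : Type u} (hB : #B ≤ χ) (n : B → ℕ) :
    #(Σ j, Fin (n j)) ≤ χ := by
  have hinj : Function.Injective fun d : (Σ j, Fin (n j)) => (d.1, (d.2 : ℕ)) := by
    rintro ⟨j, x⟩ ⟨j', x'⟩ h
    obtain ⟨rfl, h⟩ := Prod.mk.inj h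
    exact congrArg (Sigma.mk j) (Fin.ext h)
  refine (mk_le_of_injective hinj).trans ?_
  rw [mk_prod, lift_uzero, mk_nat, lift_aleph0]
  exact mul_le_of_le hχ hB hχ

theorem power_mk_sigma_fin_le {κ μ : Cardinal.{u}} (hμ : ℵ₀ ≤ μ) (hκ : κ ≠ 0) {B : Type u}
    (hB : #B = κ) (n : B → ℕ) : (μ ^ κ) ^ #(Σ j, Fin (n j)) ≤ μ ^ κ := by
  have hχ : ℵ₀ ≤ μ ^ κ := hμ.trans (self_le_power μ (Cardinal.one_le_iff_ne_zero.2 hκ))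
  rcases lt_or_ge κ ℵ₀ with hfin | hinf
  · have : Finite B := mk_lt_aleph0_iff.1 (hB ▸ hfin)
    obtain ⟨m, hm⟩ := lt_aleph0.1 (mk_lt_aleph0_iff.2 (inferInstance : Finite (Σ j, Fin (n j))))
    rw [hm]
    exact power_nat_le hχ
  · have hD : #(Σ j, Fin (n j)) ≤ κ := mk_sigma_fin_le hinf hB.le n
    rw [← power_mul]
    refine power_le_power_left (aleph0_pos.trans_le hμ).ne' ?_
    exact mul_le_of_le hinf le_rfl hD

theorem mk_sigma_term_fin_le {T : FirstOrder.Language.{u, u}} {μ : Cardinal.{u}} (hμ : ℵ₀ ≤ μ)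
    (hT : T.card ≤ μ) : #(Σ n, T.Term (Fin n)) ≤ μ := by
  rw [mk_congr (Equiv.sigmaCongrRight fun n =>
    Term.relabelEquiv (Equiv.emptySum PEmpty.{1} (Fin n)).symm), Term.card_sigma]
  refine max_le hμ (le_trans ?_ hT)
  rw [Language.card_eq_card_functions_add_card_relations]
  simp

theorem AEC.aleph0_le_LS {L : FirstOrder.Language.{u, u}} (K : AEC L) : ℵ₀ ≤ K.LS :=
  le_add_self.trans (csInf_mem K.exists_lst : LSTProperty K.Mem K.Le K.LS).1

/-! ### The order property in all lengths -/

theorem theorem2p6 {L : FirstOrder.Language.{u, u}} (K : AEC L) (hK : K.ArbitrarilyLarge)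
    (lam κ : Cardinal.{u}) (hlam : K.LS < lam) (hκ : κ < lam)
    (Φ : ProperTemplate L) (hΦ : K.IsBlueprint K.LS Φ)
    (hpow : K.LS ^ κ < lam)
    (hN : K.ModelHasOrderProperty (Φ.EM lam.ord.ToType) κ K.LS (Order.succ (K.LS ^ κ))) :
    K.HasOrderProperty κ K.LS := by
  obtain ⟨hmem, a, A, hA, hne⟩ := hN
  have hLS := K.aleph0_le_LS
  -- For `κ = 0` all sequences are empty, and there is no order property of length `2`.
  have hκ0 : κ ≠ 0 := by
    rintro rfl
    have : Nontrivial (Order.succ (K.LS ^ (0 : Cardinal))).ord.ToType := by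
      rw [← one_lt_iff_nontrivial, mk_toType, card_ord, power_zero]
      exact Order.lt_succ 1
    have : IsEmpty (0 : Cardinal.{u}).ord.ToType := by
      rw [← mk_eq_zero_iff, mk_toType, card_ord]
    obtain ⟨i, j, hij⟩ := exists_pair_lt (Order.succ (K.LS ^ (0 : Cardinal))).ord.ToType
    refine hne i j i j hij hij ?_
    rw [Subsingleton.elim (a i) (a j)]
  have hχ : ℵ₀ ≤ K.LS ^ κ := hLS.trans (self_le_power _ (Cardinal.one_le_iff_ne_zero.2 hκ0))
  intro θ
  rcases isEmpty_or_nonempty θ.ord.ToType with hθ | ⟨⟨α₀⟩⟩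
  · exact ⟨Φ.EM lam.ord.ToType, inferInstance, hmem, isEmptyElim, ∅, by simp, isEmptyElim⟩
  have hgen := Φ.isGeneratedBy_EM lam.ord.ToType
  -- Write all the elements involved as terms; by pigeonhole, the terms defining the entries of the
  -- sequence `a i` do not depend on `i`.
  choose rA vA hvA using fun y : A => hgen.exists_fin_term_realize_eq y.1
  choose r v hv using fun i j => hgen.exists_fin_term_realize_eq (a i j)
  obtain ⟨r₀, hr₀⟩ := (strictlyBounding_succ hχ).exists_fiber hχ r <| by
    simp only [mk_pi, prod_const', mk_toType, card_ord]
    exact power_le_power_right (mk_sigma_term_fin_le hLS hΦ.card_le)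
  have hw : ∀ i : {i // r i = r₀}, ∀ j, ∃ w : Fin (r₀ j).1 → lam.ord.ToType,
      (r₀ j).2.realize (Φ.skeleton _ ∘ w) = a i.1 j := by
    rintro ⟨i, rfl⟩ j
    exact ⟨v i j, hv i j⟩
  choose w hw using hw
  have hE : #(Σ y : A, Fin (rA y).1) ≤ K.LS ^ κ :=
    mk_sigma_fin_le hχ (hA.trans (self_le_power _ (Cardinal.one_le_iff_ne_zero.2 hκ0))) _
  obtain ⟨f, hf, hind⟩ := hr₀.exists_orderIndiscernible hχ
    (power_mk_sigma_fin_le hLS hκ0 (by rw [mk_toType, card_ord]) fun j => (r₀ j).1) hE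
    (fun i (d : Σ j, Fin (r₀ j).1) => w i d.1 d.2) (fun e => vA e.1 e.2)
  obtain ⟨J, _, t, ht⟩ := hind.exists_stretch (Θ := θ.ord.ToType)
  let s : Fin 3 → ((Σ y : A, Fin (rA y).1) ⊕ (Σ j, Fin (r₀ j).1)) → lam.ord.ToType :=
    fun p => Sum.elim (fun e => vA e.1 e.2) fun d => w (f p) d.1 d.2
  -- The base set and the sequences in the stretched model.
  have hbase : Function.Injective fun y : A =>
      (rA y).2.realize fun m => Φ.skeleton J (t α₀ (Sum.inl ⟨y, m⟩)) := fun y z hyz => by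
    have h := hΦ.term_realize_eq_iff (v := s 0) (w := t α₀)
      (fun x x' => (ht α₀ α₀ 0 0 (by simp) x x').symm)
      ((rA y).2.relabel fun m => Sum.inl ⟨y, m⟩) ((rA z).2.relabel fun m => Sum.inl ⟨z, m⟩)
    simp only [Term.realize_relabel] at h
    exact Subtype.ext ((hvA y).symm.trans ((h.2 hyz).trans (hvA z)))
  let base : A ↪ Φ.EM J := ⟨_, hbase⟩
  let b : θ.ord.ToType → κ.ord.ToType → Φ.EM J := fun α j =>
    (r₀ j).2.realize fun m => Φ.skeleton J (t α (Sum.inr ⟨j, m⟩))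
  let e : A ↪ Set.range base := base.codRestrict _ fun y => ⟨y, rfl⟩
  have key : ∀ α β p q, cmp α β = cmp p q →
      AEC.GaloisType.restrict e (K.gtp (hΦ.mem J) (Sum.elim (b α) (b β)) (Set.range base)) =
        K.gtp hmem (Sum.elim (a (f p)) (a (f q))) A := by
    intro α β p q h
    have hvw : ∀ x y : Bool × ((Σ y : A, Fin (rA y).1) ⊕ (Σ j, Fin (r₀ j).1)),
        s (cond x.1 q p) x.2 ≤ s (cond y.1 q p) y.2 ↔
          t (cond x.1 β α) x.2 ≤ t (cond y.1 β α) y.2 := by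
      rintro ⟨x₁, x⟩ ⟨y₁, y⟩
      refine (ht _ _ _ _ ?_ x y).symm
      cases x₁ <;> cases y₁ <;> simp [h, cmp_eq_cmp_symm.1 h]
    have hbase0 : ∀ y p, t p (Sum.inl y) = t α₀ (Sum.inl y) := fun y p => by
      obtain ⟨u, v, -, huv, -⟩ := exists_fin_three_cmp p α₀ α₀
      exact le_antisymm ((ht _ _ _ _ huv.symm _ _).2 le_rfl)
        ((ht _ _ _ _ (cmp_eq_cmp_symm.1 huv.symm) _ _).2 le_rfl)
    have := hΦ.galoisType_eq hvw
      (fun y => (rA y).2.relabel fun m => (false, Sum.inl ⟨y, m⟩))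
      (Sum.elim (fun j => (r₀ j).2.relabel fun m => (false, Sum.inr ⟨j, m⟩))
        fun j => (r₀ j).2.relabel fun m => (true, Sum.inr ⟨j, m⟩))
      (Function.Embedding.subtype (· ∈ A)) (e.trans (Function.Embedding.subtype _))
      (fun y => by
        rw [Term.realize_relabel]
        exact (hvA y).symm)
      (fun y => by
        rw [Term.realize_relabel]
        change base y = _
        refine congrArg (fun g => (rA y).2.realize g) (funext fun m => ?_)
        exact congrArg _ (hbase0 _ _).symm)
    refine Eq.trans ?_ (this.symm.trans ?_)
    · refine congrArg (fun g => Quot.mk _ (AEC.Triple.mk (Φ.EM J) (hΦ.mem J) _ g)) (funext ?_)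
      rintro (j | j)
      all_goals
        simp only [Sum.elim_inl, Sum.elim_inr, Term.realize_relabel]
        rfl
    · refine congrArg (fun g => Quot.mk _ (AEC.Triple.mk (Φ.EM _) hmem _ g)) (funext ?_)
      rintro (j | j)
      · exact (Term.realize_relabel (t := (r₀ j).2)).trans (hw (f p) j)
      · exact (Term.realize_relabel (t := (r₀ j).2)).trans (hw (f q) j)
  refine ⟨Φ.EM J, inferInstance, hΦ.mem J, b, Set.range base, mk_range_le.trans hA,
    fun α β γ δ hαβ hγδ h => hne (f 0) (f 1) (f 0) (f 1) hf hf ?_⟩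
  rw [← key α β 0 1, ← key δ γ 1 0, h]
  · exact (cmp_eq_gt_iff _ _).2 hγδ
  · exact (cmp_eq_lt_iff _ _).2 hαβ
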